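/- Let $\mathbb{F}$ be a field and $k\ge 1$ an integer. All simplicial complexes are finite; $V(X)$ is the vertex set of $X$, $f_0(X)=\#V(X)$, $X[A]$ is the subcomplex of $X$ induced on $A\subseteq V(X)$, $\mathrm{lk}(s,X)=\{t: s\cap t=\emptyset,\ s\cup t\in X\}$ is the link of a face $s$, $\mathrm{Skel}_j(X)$ is the subcomplex of the faces of dimension at most $j$, and $\tilde\beta_i(X)$ are the reduced Betti numbers over $\mathbb{F}$, with $\tilde\beta_i=\beta_i-\delta_{i0}$ for $i\ge 0$ (so $\tilde\beta_0(\emptyset)=-1$ for the complex without vertices). Put $$\sigma_i(X;\mathbb{F})=\sum_{A\subseteq V(X)}\frac{\tilde\beta_i(X[A])}{\binom{f_0(X)}{\#A}}\quad (i\ge 0),$$ $$\mu_0(X;\mathbb{F})=\sum_{x\in V(X)}\frac{1}{1+f_0(\mathrm{lk}(x,X))},\qquad \mu_i(X;\mathbb{F})=\sum_{x\in V(X)}\frac{\delta_{i1}+\sigma_{i-1}(\mathrm{lk}(x,X);\mathbb{F})}{1+f_0(\mathrm{lk}(x,X))}\quad (i\ge 1).$$ An $\mathbb{F}$-homology manifold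 without boundary of dimension $d$ is a $d$-dimensional complex in which the link of every nonempty face $s$ has the reduced $\mathbb{F}$-homology of a sphere of dimension $d-\#s$. An $\mathbb{F}$-homology manifold with boundary of dimension $n\geq 1$ is an $n$-dimensional complex $\Delta$ in which the link of every nonempty face $s$ either has the reduced $\mathbb{F}$-homology of a sphere of dimension $n-\#s$ or is $\mathbb{F}$-acyclic, and in which the nonempty faces $s$ of the second kind, together with the empty face, form an $\mathbb{F}$-homology manifold without boundary of dimension $n-1$, the boundary $\partial\Delta$. An $n$-dimensional $\mathbb{F}$-homology manifold $\Delta$ with boundary is $k$-stacked if $\mathrm{Skel}_{n-1-k}(\Delta)=\mathrm{Skel}_{n-1-k}(\partial\Delta)$. An $\mathbb{F}$-homology manifold without boundary of dimension $d$ is $k$-stacked if it is the boundary of a $k$-stacked $\mathbb{F}$-homology manifold with boundary of dimension $d+1$. 1. If $\Delta$ is a $k$-stacked $\mathbb{F}$-homology manifold with boundary, then $\mu_i(\Delta;\mathbb{F})=0$ for all $i\ge k+1$. 2. If $M$ is a $k$-stacked $\mathbb{F}$-homology manifold without boundary of dimension $d\ge 2k+2$, then $\mu_i(M;\mathbb{F})=0$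 for $k+1\le i\le d-k-1$. -/

import Mathlib

namespace PreAbstractSimplicialComplex

variable {ι : Type*}

/-- The induced subcomplex `X[A]` on a set `A` of vertices. (Here and below a complex is given by
its nonempty faces; the empty face is understood to belong to every complex.) -/
def induced (X : PreAbstractSimplicialComplex ι) (A : Finset ι) :
    PreAbstractSimplicialComplex ι where
  faces := {s | s ∈ X.faces ∧ s ⊆ A}
  isRelLowerSet_faces := fun {_} h =>
    ⟨(X.isRelLowerSet_faces h.1).1, fun _ hts ht =>
      ⟨(X.isRelLowerSet_faces h.1).2 hts ht, hts.trans h.2⟩⟩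

/-- The link of `s` in `X`: the nonempty faces `t` disjoint from `s` with `s ∪ t` a face. -/
def link [DecidableEq ι] (X : PreAbstractSimplicialComplex ι) (s : Finset ι) :
    PreAbstractSimplicialComplex ι where
  faces := {t | t.Nonempty ∧ Disjoint s t ∧ s ∪ t ∈ X.faces}
  isRelLowerSet_faces := fun {_} h =>
    ⟨h.1, fun _ hut hu => ⟨hu, h.2.1.mono_right hut,
      (X.isRelLowerSet_faces h.2.2).2 (Finset.union_subset_union_right hut)
        (hu.mono Finset.subset_union_right)⟩⟩

/-- `X` has dimension `n`: the largest faces have `n + 1` vertices. -/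
def HasDim (X : PreAbstractSimplicialComplex ι) (n : ℕ) : Prop :=
  (∃ s ∈ X, s.card = n + 1) ∧ ∀ s ∈ X, s.card ≤ n + 1

open scoped Classical in
/-- The vertex set `V(X)`, so that `f₀(X)` is its cardinality. -/
noncomputable def vertices [Fintype ι] (X : PreAbstractSimplicialComplex ι) : Finset ι :=
  Finset.univ.filter fun v => {v} ∈ X

/-- The dimension of the quotient `Z / B` of a subspace `Z` by a subspace `B ≤ Z`. -/
noncomputable def finrankQuotient {F V : Type*} [Field F] [AddCommGroup V] [Module F V]
    (Z B : Submodule F V) : ℕ :=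
  Module.finrank F (Z ⧸ B.submoduleOf Z)

section Homology

variable (F : Type*) [Field F] [LinearOrder ι]

/-- The simplicial boundary operator on all finite chains, simplices being oriented by the order of
the vertices: `s ↦ ∑ (-1) ^ j • (s without its j-th vertex)`, counting from `j = 0`. In particular
the boundary of a vertex is the empty face and that of the empty face is `0` (augmented chains). -/
noncomputable def bdry : (Finset ι →₀ F) →ₗ[F] (Finset ι →₀ F) :=
  Finsupp.linearCombination F fun s =>
    ∑ v ∈ s, Finsupp.single (s.erase v) ((-1 : F) ^ (s.filter (· < v)).card)

variable (X : PreAbstractSimplicialComplex ι)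

/-- The augmented `i`-chains of `X`: spanned by the faces with `i + 1` vertices, among them the
empty face, of dimension `-1`. -/
noncomputable def chains (i : ℤ) : Submodule F (Finset ι →₀ F) :=
  Finsupp.supported F F {s | (s ∈ X ∨ s = ∅) ∧ (s.card : ℤ) = i + 1}

/-- The `i`-cycles of the augmented chain complex of `X`. -/
noncomputable def cycles (i : ℤ) : Submodule F (Finset ι →₀ F) :=
  X.chains F i ⊓ LinearMap.ker (bdry F)

/-- The `i`-boundaries of the augmented chain complex of `X`. -/
noncomputable def boundaries (i : ℤ) : Submodule F (Finset ι →₀ F) :=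
  (X.chains F (i + 1)).map (bdry F)

/-- The reduced Betti number of `X` in dimension `i`: the dimension of the reduced simplicial
homology of `X` with coefficients in `F`, cycles modulo boundaries. -/
noncomputable def reducedBetti (i : ℤ) : ℕ :=
  finrankQuotient (X.cycles F i) (X.boundaries F i)

/-- `X` has the reduced homology of a sphere of dimension `m` (the sphere of dimension `-1` being
the complex whose only face is the empty one). -/
def HasSphereHomology (m : ℤ) : Prop :=
  ∀ i : ℤ, X.reducedBetti F i = if i = m then 1 else 0

/-- `X` is acyclic: it has the reduced homology of a ball. -/
def HasBallHomology : Prop :=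
  ∀ i : ℤ, X.reducedBetti F i = 0

/-- `X` is an `F`-homology manifold without boundary, of dimension `n`: the link of each nonempty
face `s` has the homology of a sphere of dimension `n - #s`. -/
structure IsHomologyManifold (n : ℕ) : Prop where
  hasDim : X.HasDim n
  link_homology : ∀ s ∈ X, (X.link s).HasSphereHomology F ((n : ℤ) - s.card)

/-- The (nonempty) boundary faces of an `F`-homology manifold `X` of dimension `n`: the faces `s`
whose link does not have the homology of a sphere of dimension `n - #s`. -/
def boundaryFaces (n : ℕ) : Set (Finset ι) :=
  {s | s ∈ X ∧ (X.link s).reducedBetti F ((n : ℤ) - s.card) = 0}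

/-- `Y` is the boundary complex of the `n`-dimensional `F`-homology manifold `X`. -/
def IsBoundary (n : ℕ) (Y : PreAbstractSimplicialComplex ι) : Prop :=
  Y.faces = X.boundaryFaces F n

/-- `X` is an `F`-homology manifold with (nonempty) boundary, of dimension `n`: the link of each
nonempty face `s` has the homology of a sphere of dimension `n - #s` or of a ball, and the boundary
faces form an `F`-homology manifold without boundary, of dimension `n - 1`. -/
structure IsHomologyManifoldWithBoundary (n : ℕ) : Prop where
  pos : 1 ≤ n
  hasDim : X.HasDim n
  link_homology : ∀ s ∈ X,
    (X.link s).HasSphereHomology F ((n : ℤ) - s.card) ∨ (X.link s).HasBallHomology F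
  boundary : ∃ Y : PreAbstractSimplicialComplex ι,
    X.IsBoundary F n Y ∧ Y.IsHomologyManifold F (n - 1)

/-- An `F`-homology manifold `X` with boundary, of dimension `n`, is `k`-stacked: each face of
dimension at most `n - 1 - k` (that is, with at most `n - k` vertices) lies in the boundary. -/
structure IsStackedWithBoundary (n k : ℕ) : Prop where
  manifold : X.IsHomologyManifoldWithBoundary F n
  skel : ∀ s ∈ X, s.card + k ≤ n → s ∈ X.boundaryFaces F n

/-- An `F`-homology manifold `X` without boundary, of dimension `d`, is `k`-stacked: it is the
boundary of a `k`-stacked manifold `Y` with boundary, of dimension `d + 1`. (For `k ≤ d` all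
vertices of such a `Y` are vertices of `X`, so that there is no loss in taking `Y` to have its
vertices in `ι`.) -/
structure IsStackedWithoutBoundary (d k : ℕ) : Prop where
  manifold : X.IsHomologyManifold F d
  exists_filling : ∃ Y : PreAbstractSimplicialComplex ι,
    Y.IsStackedWithBoundary F (d + 1) k ∧ Y.IsBoundary F (d + 1) X

variable [Fintype ι]

open scoped Classical in
/-- The reduced Betti numbers `β̃_i = β_i - δ_{i0}`, `i ≥ 0`, that enter the sigma-vector. They are
the dimensions of reduced homology, except that this formula gives the complex without vertices
(for which `β_0 = 0`) the value `β̃_0 = -1`. -/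
noncomputable def bettiTilde (i : ℕ) : ℤ :=
  if X = ⊥ ∧ i = 0 then -1 else X.reducedBetti F i

/-- The entries `σ_i` of the sigma-vector, `i ≥ 0`. (For `i > dim X` all terms vanish.) -/
noncomputable def sigma (i : ℕ) : ℚ :=
  ∑ A ∈ X.vertices.powerset,
    ((X.induced A).bettiTilde F i : ℚ) / (X.vertices.card.choose A.card : ℚ)

/-- The entries `μ_i` of the mu-vector. -/
noncomputable def mu : ℕ → ℚ
  | 0 => ∑ x ∈ X.vertices, 1 / (1 + ((X.link {x}).vertices.card : ℚ))
  | i + 1 => ∑ x ∈ X.vertices,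
      ((if i + 1 = 1 then 1 else 0) + (X.link {x}).sigma F i) /
        (1 + ((X.link {x}).vertices.card : ℚ))

end Homology

end PreAbstractSimplicialComplex

/-! Everything reduces to one vanishing: in a `k`-stacked manifold with boundary, every induced
subcomplex of a vertex link has zero reduced homology in dimensions at least `k`. Stackedness puts
all small faces in the boundary, so their links are acyclic. The link of a vertex inherits this,
since links in a link are links in the whole complex. By Mayer-Vietoris, `H̃_j(X[A])` embeds in
`H̃_j(X[A ∪ v])` as soon as `H̃_j(lk(v, X)[A]) = 0`. One therefore deletes vertices one at a time
from the acyclic complex `X`, and the links `lk(v, X)` are handled by induction on the maximal size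
of a face (`induced_cycles_le_boundaries`). For the boundary `M` of a stacked `Y`, the vertex links
of `M` and `Y` agree on all faces that matter for homology in the given range
(`reducedBetti_congr`), so the vanishing passes from `Y` to `M`. -/

namespace PreAbstractSimplicialComplex

/-! ### Chains and induced subcomplexes. -/

section Basic

variable {ι : Type*} (F : Type*) [Field F]

/-- The chains supported on simplices that avoid the vertex `v`. -/
noncomputable def avoiding (v : ι) : Submodule F (Finset ι →₀ F) :=
  Finsupp.supported F F {s | v ∉ s}

variable {F} {X Y : PreAbstractSimplicialComplex ι}

/-- Reduces linear statements about chains to single simplices. The motive depends on the membership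
proof so that the lemma serves as an eliminator for `induction`. -/
lemma supported_induction {S : Set (Finset ι)} {P : ∀ x, x ∈ Finsupp.supported F F S → Prop}
    (single : ∀ s (hs : s ∈ S), P (Finsupp.single s 1) (Finsupp.single_mem_supported F 1 hs))
    (zero : P 0 (zero_mem _)) (add : ∀ x y hx hy, P x hx → P y hy → P (x + y) (add_mem hx hy))
    (smul : ∀ (c : F) x hx, P x hx → P (c • x) (Submodule.smul_mem _ c hx))
    {x : Finset ι →₀ F} (hx : x ∈ Finsupp.supported F F S) : P x hx := by
  revert hx
  suffices ∀ hx : x ∈ Submodule.span F ((fun s => Finsupp.single s (1 : F)) '' S),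
      P x (Finsupp.supported_eq_span_single F S ▸ hx) from
    fun hx => this (Finsupp.supported_eq_span_single F S ▸ hx)
  intro hx
  induction hx using Submodule.span_induction with
  | mem x h => obtain ⟨s, hs, rfl⟩ := h; exact single s hs
  | zero => exact zero
  | add x y _ _ hx hy => exact add x y _ _ hx hy
  | smul c x _ hx => exact smul c x _ hx

lemma mem_induced {A s : Finset ι} : s ∈ X.induced A ↔ s ∈ X ∧ s ⊆ A := Iff.rfl

lemma nonempty_of_mem {s : Finset ι} (hs : s ∈ X) : s.Nonempty := (X.isRelLowerSet_faces hs).1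

lemma mem_of_subset {s t : Finset ι} (hs : s ∈ X) (hts : t ⊆ s) (ht : t.Nonempty) : t ∈ X :=
  (X.isRelLowerSet_faces hs).2 hts ht

lemma induced_mono (hXY : X ≤ Y) {A B : Finset ι} (hAB : A ⊆ B) :
    X.induced A ≤ Y.induced B := fun _ h => ⟨hXY h.1, h.2.trans hAB⟩

lemma chains_mono (hXY : X ≤ Y) (i : ℤ) : X.chains F i ≤ Y.chains F i :=
  Finsupp.supported_mono fun _ h => ⟨h.1.imp_left fun hs => hXY hs, h.2⟩

lemma chains_eq_bot {i : ℤ} (hi : 0 ≤ i) (h : ∀ s ∈ X, (s.card : ℤ) ≤ i) :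
    X.chains F i = ⊥ := by
  refine (congrArg _ (Set.eq_empty_of_forall_notMem fun s hs => ?_)).trans
    Finsupp.supported_empty
  rcases hs with ⟨hs | rfl, hc⟩
  · have := h s hs; omega
  · simp at hc; omega

lemma chains_congr {i : ℤ} (h : ∀ s : Finset ι, (s.card : ℤ) = i + 1 → (s ∈ X ↔ s ∈ Y)) :
    X.chains F i = Y.chains F i := by
  refine congrArg _ (Set.ext fun s => ?_)
  simp only [Set.mem_ofPred_eq]
  constructor
  · rintro ⟨h1, h2⟩; exact ⟨h1.imp_left (h s h2).1, h2⟩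
  · rintro ⟨h1, h2⟩; exact ⟨h1.imp_left (h s h2).2, h2⟩

lemma induced_univ [Fintype ι] : X.induced Finset.univ = X :=
  SetLike.ext fun s => by simp [mem_induced]

lemma chains_le_avoiding {v : ι} (hv : ∀ s ∈ X, v ∉ s) (i : ℤ) :
    X.chains F i ≤ avoiding F v := by
  refine Finsupp.supported_mono fun s h => ?_
  rcases h.1 with hs | rfl
  · exact hv s hs
  · simp

end Basic

/-! ### The cone over a chain and its boundary. -/

section Cone

variable {ι : Type*} [LinearOrder ι] (F : Type*) [Field F]

/-- The cone operator `s ↦ v * s` on chains, with the sign that orients `v * s` with `v` first. -/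
noncomputable def cone (v : ι) : (Finset ι →₀ F) →ₗ[F] (Finset ι →₀ F) :=
  Finsupp.linearCombination F fun s =>
    Finsupp.single (insert v s) ((-1 : F) ^ (s.filter (· < v)).card)

/-- The contraction `v * s ↦ s` on chains, vanishing on the simplices without the vertex `v`. -/
noncomputable def contraction (v : ι) : (Finset ι →₀ F) →ₗ[F] (Finset ι →₀ F) :=
  Finsupp.linearCombination F fun s =>
    if v ∈ s then Finsupp.single (s.erase v) ((-1 : F) ^ (s.filter (· < v)).card) else 0

variable {F}

lemma cone_single (v : ι) (s : Finset ι) (c : F) :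
    cone F v (Finsupp.single s c) =
      Finsupp.single (insert v s) (c * (-1 : F) ^ (s.filter (· < v)).card) := by
  simp [cone, Finsupp.linearCombination_single]

lemma bdry_single (s : Finset ι) (c : F) :
    bdry F (Finsupp.single s c) =
      ∑ v ∈ s, Finsupp.single (s.erase v) (c * (-1 : F) ^ (s.filter (· < v)).card) := by
  simp [bdry, Finsupp.linearCombination_single, Finset.smul_sum]

lemma contraction_of_avoiding {v : ι} {x : Finset ι →₀ F} (hx : x ∈ avoiding F v) :
    contraction F v x = 0 := by
  induction hx using supported_induction with
  | single s hs =>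
    have hs : v ∉ s := hs
    simp [contraction, Finsupp.linearCombination_single, hs]
  | zero => simp
  | add x y _ _ hx hy => simp [hx, hy]
  | smul c x _ hx => simp [hx]

lemma contraction_cone {v : ι} {x : Finset ι →₀ F} (hx : x ∈ avoiding F v) :
    contraction F v (cone F v x) = x := by
  induction hx using supported_induction with
  | single s hs =>
    have hs : v ∉ s := hs
    rw [cone_single]
    simp [contraction, Finsupp.linearCombination_single, hs, Finset.filter_insert, ← mul_pow]
  | zero => simp
  | add x y _ _ hx hy => simp [hx, hy]
  | smul c x _ hx => simp [hx]

lemma bdry_cone {v : ι} {x : Finset ι →₀ F} (hx : x ∈ avoiding F v) :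
    bdry F (cone F v x) = x - cone F v (bdry F x) := by
  induction hx using supported_induction with
  | single s hs =>
    have hs : v ∉ s := hs
    rw [cone_single, bdry_single, bdry_single, Finset.sum_insert hs, map_sum, sub_eq_add_neg,
      ← Finset.sum_neg_distrib]
    congr 1
    · simp [hs, Finset.filter_insert, ← mul_pow]
    · refine Finset.sum_congr rfl fun w hw => ?_
      have hwv : v ≠ w := fun h => hs (h ▸ hw)
      rw [cone_single, Finset.erase_insert_of_ne hwv, ← Finsupp.single_neg]
      congr 1
      -- If `v < w`, adding `v` raises the position of `w` by one; if `w < v`, removing `w` lowers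
      -- the position of `v` by one. Either way the signs differ by exactly `-1`.
      rw [Finset.filter_insert, Finset.filter_erase]
      rcases lt_or_gt_of_ne hwv with h | h
      · rw [if_pos h, Finset.card_insert_of_notMem (by simp [hs]),
          Finset.erase_eq_of_notMem (by simp [h.le])]
        ring
      · have hmem : w ∈ s.filter (· < v) := by simp [hw, h]
        rw [if_neg h.asymm, ← Finset.card_erase_add_one hmem]
        ring
  | zero => simp
  | add x y _ _ hx hy => simp only [map_add, hx, hy]; abel
  | smul c x _ hx => simp only [map_smul, hx, smul_sub]

end Cone

/-! ### Links and the Mayer-Vietoris step. -/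

section Chains

variable {ι : Type*} [LinearOrder ι] {F : Type*} [Field F] {X Y : PreAbstractSimplicialComplex ι}

lemma mem_link {s t : Finset ι} :
    t ∈ X.link s ↔ t.Nonempty ∧ Disjoint s t ∧ s ∪ t ∈ X := Iff.rfl

lemma link_le (s : Finset ι) : X.link s ≤ X := fun _ ht =>
  mem_of_subset ht.2.2 Finset.subset_union_right ht.1

lemma link_empty : X.link ∅ = X := by
  refine SetLike.ext fun s => ?_
  simpa [mem_link] using fun h : s ∈ X => nonempty_of_mem h

lemma link_link {s t : Finset ι} (ht : t ∈ X.link s) : (X.link s).link t = X.link (s ∪ t) := by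
  refine SetLike.ext fun u => ?_
  simp only [mem_link, Finset.disjoint_union_right, Finset.disjoint_union_left,
    Finset.union_assoc]
  have : (t ∪ u).Nonempty := ht.1.mono Finset.subset_union_left
  have := ht.2.1
  tauto

lemma bdry_mem_chains {i : ℤ} {x : Finset ι →₀ F} (hx : x ∈ X.chains F i) :
    bdry F x ∈ X.chains F (i - 1) := by
  induction hx using supported_induction with
  | single s hs =>
    rw [bdry_single]
    refine Submodule.sum_mem _ fun v hv => Finsupp.single_mem_supported F _ ⟨?_, ?_⟩
    · rcases (s.erase v).eq_empty_or_nonempty with h | h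
      · exact Or.inr h
      · rcases hs.1 with hs | rfl
        · exact Or.inl (mem_of_subset hs (Finset.erase_subset _ _) h)
        · simp at hv
    · have := Finset.card_erase_add_one hv
      have := hs.2
      omega
  | zero => simp
  | add x y _ _ hx hy => rw [map_add]; exact add_mem hx hy
  | smul c x _ hx => rw [map_smul]; exact Submodule.smul_mem _ _ hx

/-- A chain of `X[A ∪ v]` is the sum of one of `X[A]` and of the cone over one of `lk(v, X)[A]`. -/
lemma exists_eq_add_cone {v : ι} {A : Finset ι} {i : ℤ}
    {c : Finset ι →₀ F} (hc : c ∈ (X.induced (insert v A)).chains F (i + 1)) :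
    ∃ a ∈ (X.induced A).chains F (i + 1), ∃ b ∈ ((X.link {v}).induced A).chains F i,
      c = a + cone F v b := by
  induction hc using supported_induction with
  | single s hs =>
    obtain ⟨hs, hcard⟩ := hs
    by_cases hvs : v ∈ s
    · refine ⟨0, zero_mem _, Finsupp.single (s.erase v) ((-1) ^ (s.filter (· < v)).card),
        Finsupp.single_mem_supported F _ ⟨?_, ?_⟩, ?_⟩
      · rcases (s.erase v).eq_empty_or_nonempty with h | h
        · exact Or.inr h
        · rcases hs with hs | rfl
          · refine Or.inl ⟨⟨h, by simp, ?_⟩, ?_⟩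
            · have : {v} ∪ s.erase v = s := by
                rw [← Finset.insert_eq, Finset.insert_erase hvs]
              rw [this]; exact hs.1
            · intro w hw
              have := hs.2 (Finset.mem_of_mem_erase hw)
              exact (Finset.mem_insert.1 this).resolve_left (Finset.ne_of_mem_erase hw)
          · simp at hvs
      · have := Finset.card_erase_add_one hvs
        omega
      · rw [zero_add, cone_single, Finset.insert_erase hvs, Finset.filter_erase,
          Finset.erase_eq_of_notMem (by simp), ← mul_pow]
        simp
    · refine ⟨Finsupp.single s 1, Finsupp.single_mem_supported F _ ⟨hs.imp_left fun h =>
        ⟨h.1, (Finset.subset_insert_iff_of_notMem hvs).1 h.2⟩, hcard⟩, 0, zero_mem _, by simp⟩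
  | zero => exact ⟨0, zero_mem _, 0, zero_mem _, by simp⟩
  | add x y _ _ hx hy =>
    obtain ⟨a, ha, b, hb, rfl⟩ := hx
    obtain ⟨a', ha', b', hb', rfl⟩ := hy
    exact ⟨a + a', add_mem ha ha', b + b', add_mem hb hb', by rw [map_add]; abel⟩
  | smul r x _ hx =>
    obtain ⟨a, ha, b, hb, rfl⟩ := hx
    exact ⟨r • a, Submodule.smul_mem _ _ ha, r • b, Submodule.smul_mem _ _ hb, by simp⟩

/-- The injectivity of `H̃_i(X[A]) → H̃_i(X[A ∪ v])` if `H̃_i(lk(v, X)[A]) = 0`, a part of the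
Mayer-Vietoris sequence. -/
lemma cycles_le_boundaries_of_insert {v : ι} {A : Finset ι} (hv : v ∉ A) {i : ℤ}
    (hlink : ((X.link {v}).induced A).cycles F i ≤ ((X.link {v}).induced A).boundaries F i)
    (hins : (X.induced (insert v A)).cycles F i ≤ (X.induced (insert v A)).boundaries F i) :
    (X.induced A).cycles F i ≤ (X.induced A).boundaries F i := by
  intro z hz
  obtain ⟨c, hc, hcz⟩ := hins
    ⟨chains_mono (induced_mono le_rfl (Finset.subset_insert v A)) i hz.1, hz.2⟩
  obtain ⟨a, ha, b, hb, rfl⟩ := exists_eq_add_cone hc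
  have hX : ∀ j, (X.induced A).chains F j ≤ avoiding F v :=
    chains_le_avoiding fun s hs h => hv (hs.2 h)
  have hL : ∀ j, ((X.link {v}).induced A).chains F j ≤ avoiding F v :=
    chains_le_avoiding fun s hs h => hv (hs.2 h)
  rw [map_add, bdry_cone (hL _ hb)] at hcz
  -- Every simplex of `v * ∂b` contains `v`, while `∂a + b - z`, to which it is equal, avoids `v`.
  -- So both vanish, and `z = ∂a + b` with `b` a cycle of the link.
  have hbz : bdry F b = 0 := by
    rw [← contraction_cone (hL _ (bdry_mem_chains hb))]
    refine contraction_of_avoiding ?_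
    have : cone F v (bdry F b) = bdry F a + b - z := by rw [← hcz]; abel
    rw [this]
    exact sub_mem (add_mem (hX _ (bdry_mem_chains ha)) (hL _ hb)) (hX _ hz.1)
  obtain ⟨e, he, heb⟩ := hlink ⟨hb, hbz⟩
  refine ⟨a + e, add_mem ha (chains_mono (induced_mono (link_le _) subset_rfl) _ he), ?_⟩
  rw [map_add, heb, ← hcz, hbz, map_zero, sub_zero]

lemma reducedBetti_eq_zero_iff [Finite ι] {i : ℤ} :
    X.reducedBetti F i = 0 ↔ X.cycles F i ≤ X.boundaries F i := by
  have : Module.Finite F (Finset ι →₀ F) := inferInstance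
  rw [reducedBetti, finrankQuotient, Module.finrank_zero_iff]
  exact Submodule.Quotient.subsingleton_iff.trans Submodule.submoduleOf_eq_top

/-- Homology in dimension `i` depends on the `(i + 1)`-skeleton only. -/
lemma reducedBetti_congr {i : ℤ} (h : ∀ s : Finset ι, (s.card : ℤ) ≤ i + 2 → (s ∈ X ↔ s ∈ Y)) :
    X.reducedBetti F i = Y.reducedBetti F i := by
  rw [reducedBetti, reducedBetti, cycles, cycles, boundaries, boundaries,
    chains_congr fun s hs => h s (by omega),
    chains_congr (i := i + 1) fun s hs => h s (by omega)]

end Chains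

/-! ### Vanishing for stacked manifolds. -/

section Stacked

variable {ι : Type*} [LinearOrder ι] [Fintype ι] {F : Type*} [Field F]

/-- If all faces of `X` have at most `N` vertices, and the links of the faces with fewer than
`N - k` vertices, among them the empty one, are acyclic, then the induced subcomplexes have no
homology in dimensions at least `k`. -/
lemma induced_cycles_le_boundaries (k : ℕ) {j : ℤ} (hj : k ≤ j) (N : ℕ)
    (X : PreAbstractSimplicialComplex ι) (hcard : ∀ s ∈ X, s.card ≤ N)
    (hlink : ∀ s, (s ∈ X ∨ s = ∅) → s.card + k + 1 ≤ N → (X.link s).HasBallHomology F)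
    (A : Finset ι) : (X.induced A).cycles F j ≤ (X.induced A).boundaries F j := by
  induction N generalizing X A with
  | zero =>
    refine inf_le_left.trans ?_
    rw [chains_eq_bot (by omega) fun s hs => by have := hcard s hs.1; omega]
    exact bot_le
  | succ N ih =>
    -- If `N < k`, faces have at most `k ≤ j` vertices, so there are no `j`-chains. Otherwise the
    -- hypothesis on links covers the empty face, and `X` itself is acyclic.
    rcases lt_or_ge N k with hN | hN
    · refine inf_le_left.trans ?_
      rw [chains_eq_bot (by omega) fun s hs => by have := hcard s hs.1; omega]
      exact bot_le
    -- Descending induction on `A`, starting from the full vertex set.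
    induction A using WellFoundedGT.induction with
    | ind A ihA =>
    by_cases hA : A = Finset.univ
    · rw [hA, induced_univ, ← reducedBetti_eq_zero_iff, ← link_empty (X := X)]
      exact hlink ∅ (Or.inr rfl) (by simpa using hN) j
    obtain ⟨v, hv⟩ : ∃ v, v ∉ A := by simpa [Finset.eq_univ_iff_forall] using hA
    have hins := ihA (insert v A) (Finset.ssubset_insert hv)
    by_cases hvX : {v} ∈ X
    · refine cycles_le_boundaries_of_insert hv (ih (X.link {v}) (fun s hs => ?_)
        (fun s hs hsN => ?_) A) hins
      · have := hcard _ hs.2.2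
        rw [Finset.card_union_of_disjoint hs.2.1, Finset.card_singleton] at this
        omega
      · rcases hs with hs | rfl
        · rw [link_link hs]
          refine hlink _ (Or.inl hs.2.2) ?_
          rw [Finset.card_union_of_disjoint hs.2.1, Finset.card_singleton]
          omega
        · rw [link_empty]
          exact hlink _ (Or.inl hvX) (by simp at hsN ⊢; omega)
    -- An element of `ι` that is not a vertex of `X` can be deleted freely.
    · have : X.induced (insert v A) = X.induced A := by
        refine SetLike.ext fun s => and_congr_right fun hs => ?_
        refine Finset.subset_insert_iff_of_notMem fun hvs => hvX ?_
        exact mem_of_subset hs (by simpa using hvs) (by simp)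
      rwa [this] at hins

/-- The induced subcomplexes of the vertex links of a `k`-stacked manifold with boundary have no
homology in dimensions at least `k`. -/
lemma IsStackedWithBoundary.reducedBetti_link_induced {k n : ℕ}
    {X : PreAbstractSimplicialComplex ι} (hX : X.IsStackedWithBoundary F n k) {x : ι}
    (hx : {x} ∈ X) {j : ℤ} (hj : k ≤ j) (A : Finset ι) :
    ((X.link {x}).induced A).reducedBetti F j = 0 := by
  have hball : ∀ s ∈ X, s.card + k ≤ n → (X.link s).HasBallHomology F := fun s hs hsk => by
    -- A sphere would have Betti number `1` in dimension `n - #s`, where that of a boundary face is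
    -- `0`.
    refine (hX.manifold.link_homology s hs).resolve_left fun h => ?_
    have := h ((n : ℤ) - s.card)
    rw [if_pos rfl, (hX.skel s hs hsk).2] at this
    exact zero_ne_one this
  have hcard : ∀ s ∈ X.link {x}, ({x} ∪ s).card = s.card + 1 := fun s hs => by
    rw [Finset.card_union_of_disjoint hs.2.1, Finset.card_singleton, add_comm]
  rw [reducedBetti_eq_zero_iff]
  refine induced_cycles_le_boundaries k hj n _ (fun s hs => ?_) (fun s hs hsk => ?_) A
  · have := hX.manifold.hasDim.2 _ hs.2.2
    rw [hcard s hs] at this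
    omega
  · rcases hs with hs | rfl
    · rw [link_link hs]
      exact hball _ hs.2.2 (by rw [hcard s hs]; omega)
    · rw [link_empty]
      exact hball _ hx (by simp at hsk ⊢; omega)

/-- The bound `1 ≤ i` excludes both the term `δ_{i1}` of the mu-vector and the exceptional value
`β̃_0(∅) = -1`. -/
lemma mu_eq_zero {X : PreAbstractSimplicialComplex ι} {i : ℕ} (hi : 1 ≤ i)
    (h : ∀ x, {x} ∈ X → ∀ A, ((X.link {x}).induced A).reducedBetti F i = 0) :
    X.mu F (i + 1) = 0 := by
  rw [mu]
  refine Finset.sum_eq_zero fun x hx => ?_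
  have hσ : (X.link {x}).sigma F i = 0 := by
    refine Finset.sum_eq_zero fun A _ => ?_
    rw [bettiTilde, if_neg (by omega), h x (by simpa [vertices] using hx) A]
    simp
  rw [hσ, if_neg (by omega)]
  simp

end Stacked

end PreAbstractSimplicialComplex

theorem corollary3 {F : Type*} [Field F] {ι : Type*} [LinearOrder ι] [Fintype ι]
    (k : ℕ) (hk : 1 ≤ k) :
    (∀ (n : ℕ) (Δ : PreAbstractSimplicialComplex ι),
      Δ.IsStackedWithBoundary F n k →
        ∀ i : ℕ, k + 1 ≤ i → Δ.mu F i = 0) ∧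
    (∀ (d : ℕ) (M : PreAbstractSimplicialComplex ι),
      M.IsStackedWithoutBoundary F d k → 2 * k + 2 ≤ d →
        ∀ i : ℕ, k + 1 ≤ i → i + k + 1 ≤ d → M.mu F i = 0) := by
  refine ⟨fun n Δ hΔ i hi => ?_, fun d M hM _ i hi hid => ?_⟩
  · obtain ⟨i, rfl⟩ : ∃ j, i = j + 1 := ⟨i - 1, by omega⟩
    exact PreAbstractSimplicialComplex.mu_eq_zero (by omega) fun x hx A =>
      hΔ.reducedBetti_link_induced hx (by omega) A
  · obtain ⟨i, rfl⟩ : ∃ j, i = j + 1 := ⟨i - 1, by omega⟩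
    obtain ⟨Y, hY, hYM⟩ := hM.exists_filling
    have hmem : ∀ s, s ∈ M ↔ s ∈ Y.boundaryFaces F (d + 1) := fun s => by
      rw [← hYM]; rfl
    refine PreAbstractSimplicialComplex.mu_eq_zero (by omega) fun x hx A => ?_
    -- The zero is written as the Betti number of the same induced subcomplex of the link in `Y`, to
    -- be compared with that in `M`.
    rw [← hY.reducedBetti_link_induced ((hmem _).1 hx).1 (j := i) (by omega) A]
    refine PreAbstractSimplicialComplex.reducedBetti_congr fun s hs => and_congr_left fun _ => ?_
    refine and_congr_right fun _ => and_congr_right fun hxs => ?_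
    refine (hmem _).trans ?_
    -- Only faces `s` with at most `i + 2` vertices matter, so `x ∪ s` has at most `i + 3`. After
    -- the shift of `i`, the upper bound reads `i + 3 + k ≤ d + 1`, exactly the range where
    -- stackedness puts faces of `Y` in `M`.
    refine ⟨fun h => h.1, fun h => hY.skel _ h ?_⟩
    rw [Finset.card_union_of_disjoint hxs, Finset.card_singleton]
    omega
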